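/- A bidirected graph $\Sigma$ has a finite node set $V$ and a finite family of edges, each of which is a link (two distinct end-nodes), a loop (two coinciding end-nodes), a half-edge (one end-node) or a loose edge (no end-node); every edge-end is labelled $+1$ or $-1$. A link or loop is positive (directed) if its two labels differ and negative (bidirected) if they agree; half-edges are negative and loose edges are positive. The incidence matrix $D_\Sigma\in\mathbb{R}^{V\times E}$ has in row $v$ and column $e$ the label of $v$ on $e$ if $e$ is a link or half-edge at $v$, $\pm2$ (twice the common label) if $e$ is a negative loop at $v$, and $0$ otherwise. A real matrix $B$ is a binet matrix if $B=R^{-1}S$, where $[R|S]$ is a full row rank incidence matrix of a bidirected graph $\Sigma$ and $R$ is a basis of its columns; $\Sigma$ with the basis $R$ is then a binet representation of $B$, and the columns of $R$ are its basic edges. A cycle is a single loop, a single half-edge, or the edge set of a closed path of links. A representation is of type I if every cycle of basic edges is a half-edge and all other basic edges are positive; it is of type II if $\Sigma$ has no half-edge, the subgraph of basic edges is connected, and exactly one basic edge is negative. For real matrices $A,B$, column vectors $a,d$ and row vectors $b,c$ of suitable sizes, $$[A\ a]\oplus_2\begin{bmatrix}b\\B\end{bmatrix}=\begin{bmatrix}A&ab\\0&B\end{bmatrix},\qquad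 \begin{bmatrix}A&a&a\\c&0&1\end{bmatrix}\oplus_3\begin{bmatrix}1&0&b\\d&d&B\end{bmatrix}=\begin{bmatrix}A&ab\\dc&B\end{bmatrix},$$ $$\begin{bmatrix}A&0\\b&1\\c&1\end{bmatrix}\oplus^3\begin{bmatrix}1&1&0\\a&d&B\end{bmatrix}=\begin{bmatrix}A&0\\D&B\end{bmatrix},$$ where in $\oplus^3$ the vectors $b,c$ are two rows of $D$ and $a,d$ are two columns of $D$, the $2\times2$ intersection $\bar D$ of these rows and columns is nonsingular, and $D=[a|d]\,\bar D^{-1}\begin{bmatrix}b\\c\end{bmatrix}$ has rank two. Let $$B_1=\begin{bmatrix}1&0&0&1&-1\\-1&1&0&0&1\\1&-1&1&0&0\\0&1&-1&1&0\\0&0&1&-1&1\end{bmatrix},\qquad B_2=\begin{bmatrix}1&1&1&1&1\\1&1&1&0&0\\1&0&1&1&0\\1&0&0&1&1\\1&1&0&0&1\end{bmatrix},$$ and let $M=B_1\oplus_2B_2$ be the $9\times 9$ 2-sum formed with the first column of $B_1$ (moved to the last position) and the first row of $B_2$, that is $$M=\begin{bmatrix}A&ab\\0&B\end{bmatrix},$$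 where $a$ is the first column of $B_1$, $A$ consists of its other columns, $b$ is the first row of $B_2$ and $B$ consists of its other rows. **Theorem.** $B_1$ and $B_2$ are totally unimodular binet matrices, but $M$ has no binet representation of type I and none of type II, and $M$ is not a binet matrix. Hence totally unimodular binet matrices are not closed under $k$-sums for $k=2,3$: there are two totally unimodular binet matrices whose 2-sum $\oplus_2$ is not binet, two whose 3-sum $\oplus_3$ is not binet, and two whose 3-sum $\oplus^3$ is not binet. -/

import Mathlib

namespace BinetSum

/-- An edge of a bidirected graph on the node set `V`. Every edge-end carries a label in
`ℤˣ = {+1, -1}` (`+1`: in-node of the edge, `-1`: out-node of the edge). -/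
inductive BidirectedEdge (V : Type) : Type
  /-- two different end-nodes `u`, `v`, labelled `s`, `t` -/
  | link (u v : V) (huv : u ≠ v) (s t : ℤˣ)
  /-- two coinciding end-nodes, labelled `s`, `t` -/
  | loop (v : V) (s t : ℤˣ)
  /-- one end-node, labelled `s` -/
  | halfEdge (v : V) (s : ℤˣ)
  /-- no end-node -/
  | loose

namespace BidirectedEdge

variable {V : Type}

/-- The sign of an edge: the labels of a positive edge differ, those of a negative edge agree;
half-edges are negative and loose edges are positive. -/
def sign : BidirectedEdge V → ℤˣ
  | link _ _ _ s t => -(s * t)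
  | loop _ s t => -(s * t)
  | halfEdge _ _ => -1
  | loose => 1

/-- The entry of the node-edge incidence matrix at the node `w`: the label of `w`, except that it
is `±2` (the common label, doubled) for a negative loop and `0` for a positive loop. -/
def entry [DecidableEq V] (w : V) : BidirectedEdge V → ℤ
  | link u v _ s t => if w = u then (s : ℤ) else if w = v then (t : ℤ) else 0
  | loop v s t => if w = v then (s : ℤ) + (t : ℤ) else 0
  | halfEdge v s => if w = v then (s : ℤ) else 0
  | loose => 0

def IsHalfEdge : BidirectedEdge V → Prop
  | halfEdge _ _ => True
  | _ => False

def IsLoop : BidirectedEdge V → Prop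
  | loop _ _ _ => True
  | _ => False

/-- The edge is a link with end-nodes `x` and `y`. -/
def Joins (x y : V) : BidirectedEdge V → Prop
  | link u v _ _ _ => (u = x ∧ v = y) ∨ (u = y ∧ v = x)
  | _ => False

end BidirectedEdge

/-- A bidirected graph with node set `V` and edges indexed by `E` (parallel edges allowed). -/
structure BidirectedGraph (V E : Type) : Type where
  edge : E → BidirectedEdge V

namespace BidirectedGraph

variable {V E m n : Type}

/-- The node-edge incidence matrix. -/
def incidence [DecidableEq V] (G : BidirectedGraph V E) : Matrix V E ℝ :=
  Matrix.of fun v e => ((G.edge e).entry v : ℝ)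

/-- A set of edges forming a cycle: a single half-edge, a single loop, or the edges of a closed
path, that is of a closed walk with at least two edges, all of them different links, which visits
no node twice (indices are cyclic). -/
def IsCycle (G : BidirectedGraph V E) (C : Set E) : Prop :=
  (∃ e, C = {e} ∧ ((G.edge e).IsHalfEdge ∨ (G.edge e).IsLoop)) ∨
  ∃ (k : ℕ) (v : Fin (k + 2) → V) (e : Fin (k + 2) → E),
    Function.Injective v ∧ Function.Injective e ∧
    (∀ i, (G.edge (e i)).Joins (v i) (v (i + 1))) ∧ C = Set.range e

/-- With the edges split into `m` and `n`, the incidence matrix is `[R | S]`, where `R` consists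
of the columns in `m` and `S` of those in `n`. -/
def basicPart [DecidableEq V] (G : BidirectedGraph V (m ⊕ n)) : Matrix V m ℝ :=
  G.incidence.submatrix id Sum.inl

/-- The columns `S` of the incidence matrix `[R | S]`. -/
def nonbasicPart [DecidableEq V] (G : BidirectedGraph V (m ⊕ n)) : Matrix V n ℝ :=
  G.incidence.submatrix id Sum.inr

/-- `G` is a binet representation of `B`, with basic edges `m` and non-basic edges `n`: the columns
`R` are invertible (equivalently, the incidence matrix `[R | S]` has full row rank and `R` is a
basis of it) and `B = R⁻¹ S`. The nodes are not identified with the rows of `B`, so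
the inverse of `R` is written as an `m × V` matrix. -/
def Represents [Fintype V] [DecidableEq V] [Fintype m] [DecidableEq m]
    (G : BidirectedGraph V (m ⊕ n)) (B : Matrix m n ℝ) : Prop :=
  ∃ Rinv : Matrix m V ℝ,
    G.basicPart * Rinv = 1 ∧ Rinv * G.basicPart = 1 ∧ B = Rinv * G.nonbasicPart

/-- Two different nodes are adjacent in the basis graph if a basic link joins them. -/
def basisGraph (G : BidirectedGraph V (m ⊕ n)) : SimpleGraph V :=
  SimpleGraph.fromRel fun x y => ∃ i : m, (G.edge (Sum.inl i)).Joins x y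

/-- Type I: every cycle formed by basic edges is a half-edge, and all other basic edges are
directed, that is positive. -/
def IsTypeI (G : BidirectedGraph V (m ⊕ n)) : Prop :=
  (∀ C : Set (m ⊕ n), C ⊆ Set.range Sum.inl → G.IsCycle C →
    ∃ e, C = {e} ∧ (G.edge e).IsHalfEdge) ∧
  ∀ i : m, ¬ (G.edge (Sum.inl i)).IsHalfEdge → (G.edge (Sum.inl i)).sign = 1

/-- Type II: the graph has no half-edge, the basis graph is connected, and exactly one basic edge
is bidirected, that is negative. -/
def IsTypeII (G : BidirectedGraph V (m ⊕ n)) : Prop :=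
  (∀ e, ¬ (G.edge e).IsHalfEdge) ∧ G.basisGraph.Connected ∧
  ∃! i : m, (G.edge (Sum.inl i)).sign = -1

end BidirectedGraph

section Binet

variable {m n : Type} [Fintype m] [DecidableEq m]

/-- `B` is a binet matrix: it has a binet representation. -/
def IsBinet (B : Matrix m n ℝ) : Prop :=
  ∃ (V : Type) (_ : Fintype V) (_ : DecidableEq V) (G : BidirectedGraph V (m ⊕ n)),
    G.Represents B

/-- `B` has a binet representation of type I. (Switching at a node does not change the represented
matrix, so it makes no difference to allow switchings here.) -/
def HasTypeIRepresentation (B : Matrix m n ℝ) : Prop :=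
  ∃ (V : Type) (_ : Fintype V) (_ : DecidableEq V) (G : BidirectedGraph V (m ⊕ n)),
    G.Represents B ∧ G.IsTypeI

/-- `B` has a binet representation of type II. -/
def HasTypeIIRepresentation (B : Matrix m n ℝ) : Prop :=
  ∃ (V : Type) (_ : Fintype V) (_ : DecidableEq V) (G : BidirectedGraph V (m ⊕ n)),
    G.Represents B ∧ G.IsTypeII

/-- Totally unimodular binet matrices. -/
def IsTUBinet (B : Matrix m n ℝ) : Prop :=
  B.IsTotallyUnimodular ∧ IsBinet B

end Binet

section Sums

variable {p q r s : Type}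

/-- The matrix `[A a]`, the first term of a 2-sum. -/
def twoSumLeft (A : Matrix p q ℝ) (a : p → ℝ) : Matrix p (q ⊕ Fin 1) ℝ :=
  Matrix.fromCols A (Matrix.replicateCol (Fin 1) a)

/-- The matrix `[b; B]` (first row `b`), the second term of a 2-sum. -/
def twoSumRight (b : s → ℝ) (B : Matrix r s ℝ) : Matrix (Fin 1 ⊕ r) s ℝ :=
  Matrix.fromRows (Matrix.replicateRow (Fin 1) b) B

/-- The 2-sum `[A a] ⊕₂ [b; B] = [A ab; 0 B]`. -/
def twoSum (A : Matrix p q ℝ) (a : p → ℝ) (b : s → ℝ) (B : Matrix r s ℝ) :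
    Matrix (p ⊕ r) (q ⊕ s) ℝ :=
  Matrix.fromBlocks A (Matrix.vecMulVec a b) 0 B

/-- The matrix `[A a a; c 0 1]`, the first term of a 3-sum `⊕₃`. -/
def threeSumLeft (A : Matrix p q ℝ) (a : p → ℝ) (c : q → ℝ) :
    Matrix (p ⊕ Fin 1) (q ⊕ Fin 2) ℝ :=
  Matrix.fromBlocks A (Matrix.replicateCol (Fin 2) a) (Matrix.replicateRow (Fin 1) c) !![0, 1]

/-- The matrix `[1 0 b; d d B]`, the second term of a 3-sum `⊕₃`. -/
def threeSumRight (b : s → ℝ) (d : r → ℝ) (B : Matrix r s ℝ) :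
    Matrix (Fin 1 ⊕ r) (Fin 2 ⊕ s) ℝ :=
  Matrix.fromBlocks !![1, 0] (Matrix.replicateRow (Fin 1) b) (Matrix.replicateCol (Fin 2) d) B

/-- The 3-sum `[A a a; c 0 1] ⊕₃ [1 0 b; d d B] = [A ab; dc B]`. -/
def threeSum (A : Matrix p q ℝ) (a : p → ℝ) (c : q → ℝ) (b : s → ℝ) (d : r → ℝ)
    (B : Matrix r s ℝ) : Matrix (p ⊕ r) (q ⊕ s) ℝ :=
  Matrix.fromBlocks A (Matrix.vecMulVec a b) (Matrix.vecMulVec d c) B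

/-- The matrix `[A 0; b 1; c 1]`, the first term of an alternative 3-sum `⊕³`. -/
def altThreeSumLeft (A : Matrix p q ℝ) (b c : q → ℝ) : Matrix (p ⊕ Fin 2) (q ⊕ Fin 1) ℝ :=
  Matrix.fromBlocks A 0 (Matrix.of ![b, c]) !![1; 1]

/-- The matrix `[1 1 0; a d B]`, the second term of an alternative 3-sum `⊕³`. -/
def altThreeSumRight (a d : r → ℝ) (B : Matrix r s ℝ) : Matrix (Fin 1 ⊕ r) (Fin 2 ⊕ s) ℝ :=
  Matrix.fromBlocks !![1, 1] 0 (Matrix.of ![a, d]).transpose B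

/-- The condition on the block `D` of an alternative 3-sum
`[A 0; b 1; c 1] ⊕³ [1 1 0; a d B] = [A 0; D B]`: `b`, `c` are two rows of `D`, `a`, `d` are two
columns of `D`, the `2 × 2` intersection `Dbar` of these rows and columns is nonsingular,
`D = [a|d] Dbar⁻¹ [b; c]`, and `D` has rank two. -/
def IsAltThreeSumBlock [Fintype q] (b c : q → ℝ) (a d : r → ℝ) (D : Matrix r q ℝ) : Prop :=
  ∃ (i : Fin 2 → r) (j : Fin 2 → q),
    D.submatrix i id = Matrix.of ![b, c] ∧
    D.submatrix id j = (Matrix.of ![a, d]).transpose ∧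
    (D.submatrix i j).det ≠ 0 ∧
    D = (Matrix.of ![a, d]).transpose * (D.submatrix i j)⁻¹ * Matrix.of ![b, c] ∧
    D.rank = 2

/-- The alternative 3-sum `[A 0; D B]`. -/
def altThreeSum (A : Matrix p q ℝ) (D : Matrix r q ℝ) (B : Matrix r s ℝ) :
    Matrix (p ⊕ r) (q ⊕ s) ℝ :=
  Matrix.fromBlocks A 0 D B

end Sums

/-- The first of the two representation matrices of `R₁₀`. -/
def B₁ : Matrix (Fin 5) (Fin 5) ℝ :=
  !![ 1,  0,  0,  1, -1;
     -1,  1,  0,  0,  1;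
      1, -1,  1,  0,  0;
      0,  1, -1,  1,  0;
      0,  0,  1, -1,  1]

/-- The second of the two representation matrices of `R₁₀`. -/
def B₂ : Matrix (Fin 5) (Fin 5) ℝ :=
  !![1, 1, 1, 1, 1;
     1, 1, 1, 0, 0;
     1, 0, 1, 1, 0;
     1, 0, 0, 1, 1;
     1, 1, 0, 0, 1]

/-- The 2-sum `M = B₁ ⊕₂ B₂`, with the first column of `B₁` (moved to the end) and the first row
of `B₂` as connecting elements. -/
def M : Matrix (Fin 5 ⊕ Fin 4) (Fin 4 ⊕ Fin 5) ℝ :=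
  twoSum (B₁.submatrix id Fin.succ) (fun i => B₁ i 0) (B₂ 0) (B₂.submatrix Fin.succ id)

end BinetSum

/-! Non-representability is a weight count. If `[R | S]` represents `M`, then `S = R M`, so the row
of each node is an integral linear functional on the 18 columns of `[I | M]`. An edge has at most
two ends, so a column has total absolute weight at most 2 over all nodes (`sum_abs_entry_le_two`),
and all functionals together weigh at most 36.

For the lower bound, the nine elements of each copy of `R₁₀` other than the connecting element split
into three triples, each forming a 4-element circuit with the connecting element. A functional with
value `c` on that element therefore weighs at least `3 * |c|` on the nine, and if `c = 0` it
vanishes there or weighs at least 4 (`weight_left`, `weight_right`). Both sides of the 2-sum share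
`c`, so a nonzero functional weighs at least 4, and at least 6 if `c ≠ 0` (`weight_M`). Since `R` is
invertible, at least nine functionals are nonzero and one of them has `c ≠ 0`, which gives 8 · 4 + 6
= 38 > 36. No binet representation exists, in particular none of type I or II.

Both `B₁` and `B₂` are binet because `R₁₀` is represented by the complete graph on five nodes with
all ten edges negative. The 3-sums are `M` bordered by a row and a column, and `not_isBinet_of_M`
tolerates the border. Their terms arise from `B₁` and `B₂` by adding parallel, unit and series
elements, which keeps them totally unimodular and binet. -/

namespace BinetSum

/-! ### Weights of node functionals, and why `M` is not binet -/

namespace BidirectedEdge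

variable {V : Type} [Fintype V] [DecidableEq V]

theorem sum_abs_entry_le_two (e : BidirectedEdge V) : ∑ v, |e.entry v| ≤ 2 := by
  have single (u : V) (a : ℤ) : ∑ w, |if w = u then a else 0| = |a| := by
    rw [Finset.sum_eq_single u] <;> simp +contextual
  have unit (s : ℤˣ) : |(s : ℤ)| = 1 := Int.isUnit_iff_abs_eq.mp s.isUnit
  cases e with
  | link u v huv s t =>
    calc ∑ w, |(link u v huv s t).entry w|
        ≤ ∑ w, (|if w = u then (s : ℤ) else 0| + |if w = v then (t : ℤ) else 0|) := by
          refine Finset.sum_le_sum fun w _ => ?_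
          simp only [entry]
          split_ifs <;> simp
      _ ≤ 2 := by simp only [Finset.sum_add_distrib, single, unit]; norm_num
  | loop v s t =>
    simp only [entry, single]
    exact (abs_add_le _ _).trans (by simp [unit])
  | halfEdge v s => simp [entry, single, unit]
  | loose => simp [entry]

end BidirectedEdge

theorem abs_add_abs_add_abs_of_add_add_eq {a b d c : ℤ} (h : a + b + d = c) :
    |c| ≤ |a| + |b| + |d| ∧ (c = 0 → 2 ≤ |a| + |b| + |d| ∨ a = 0 ∧ b = 0 ∧ d = 0) := by
  rcases abs_cases a with ha | ha <;> rcases abs_cases b with hb | hb <;>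
    rcases abs_cases d with hd | hd <;> rcases abs_cases c with hc | hc <;> omega

/-- Weight of a linear functional on the nine elements of the left summand other than the
connecting element, where it takes the value `c`. -/
theorem weight_left {y₀ y₁ y₂ y₃ y₄ z₁ z₂ z₃ z₄ c : ℤ} (hc : c = y₀ - y₁ + y₂)
    (h₁ : z₁ = y₁ - y₂ + y₃) (h₂ : z₂ = y₂ - y₃ + y₄) (h₃ : z₃ = y₀ + y₃ - y₄)
    (h₄ : z₄ = -y₀ + y₁ + y₄) :
    3 * |c| ≤ |y₀| + |y₁| + |y₂| + |y₃| + |y₄| + (|z₁| + |z₂| + |z₃| + |z₄|) ∧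
    (c = 0 → 4 ≤ |y₀| + |y₁| + |y₂| + |y₃| + |y₄| + (|z₁| + |z₂| + |z₃| + |z₄|) ∨
      y₀ = 0 ∧ y₁ = 0 ∧ y₂ = 0 ∧ y₃ = 0 ∧ y₄ = 0) := by
  -- Three disjoint triples, each with signed sum `c`, cover the nine elements. When `c = 0`, a
  -- nonzero triple weighs at least 2, and two vanishing triples force all `yᵢ` to vanish, whence
  -- the bound 4.
  have k₁ := abs_add_abs_add_abs_of_add_add_eq (show y₀ + -y₁ + y₂ = c by omega)
  have k₂ := abs_add_abs_add_abs_of_add_add_eq (show y₃ + z₂ + -z₄ = c by omega)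
  have k₃ := abs_add_abs_add_abs_of_add_add_eq (show y₄ + -z₁ + z₃ = c by omega)
  simp only [abs_neg] at k₁ k₂ k₃
  have := abs_nonneg c
  generalize |y₀| = A₀ at *; generalize |y₁| = A₁ at *; generalize |y₂| = A₂ at *
  generalize |y₃| = A₃ at *; generalize |y₄| = A₄ at *; generalize |z₁| = C₁ at *
  generalize |z₂| = C₂ at *; generalize |z₃| = C₃ at *; generalize |z₄| = C₄ at *
  generalize |c| = C at *
  omega

/-- Weight of a linear functional on the nine elements of the right summand other than the
connecting element, where it takes the value `c`. -/
theorem weight_right {u₀ u₁ u₂ u₃ w₀ w₁ w₂ w₃ w₄ c : ℤ} (h₀ : w₀ = c + u₀ + u₁ + u₂ + u₃)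
    (h₁ : w₁ = c + u₀ + u₃) (h₂ : w₂ = c + u₀ + u₁) (h₃ : w₃ = c + u₁ + u₂)
    (h₄ : w₄ = c + u₂ + u₃) :
    3 * |c| ≤ |u₀| + |u₁| + |u₂| + |u₃| + (|w₀| + |w₁| + |w₂| + |w₃| + |w₄|) ∧
    (c = 0 → 4 ≤ |u₀| + |u₁| + |u₂| + |u₃| + (|w₀| + |w₁| + |w₂| + |w₃| + |w₄|) ∨
      u₀ = 0 ∧ u₁ = 0 ∧ u₂ = 0 ∧ u₃ = 0) := by
  -- The same argument with the corresponding partition into triples for `B₂`.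
  have k₁ := abs_add_abs_add_abs_of_add_add_eq (show -u₀ + -u₁ + w₂ = c by omega)
  have k₂ := abs_add_abs_add_abs_of_add_add_eq (show -u₂ + -u₃ + w₄ = c by omega)
  have k₃ := abs_add_abs_add_abs_of_add_add_eq (show -w₀ + w₁ + w₃ = c by omega)
  simp only [abs_neg] at k₁ k₂ k₃
  have := abs_nonneg c
  generalize |u₀| = A₀ at *; generalize |u₁| = A₁ at *; generalize |u₂| = A₂ at *
  generalize |u₃| = A₃ at *; generalize |w₀| = C₀ at *; generalize |w₁| = C₁ at *
  generalize |w₂| = C₂ at *; generalize |w₃| = C₃ at *; generalize |w₄| = C₄ at *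
  generalize |c| = C at *
  omega

theorem M_inl_inl (i : Fin 5) (j : Fin 4) : M (.inl i) (.inl j) = B₁ i j.succ := rfl

theorem M_inl_inr (i j : Fin 5) : M (.inl i) (.inr j) = B₁ i 0 * B₂ 0 j := rfl

theorem M_inr_inl (i j : Fin 4) : M (.inr i) (.inl j) = 0 := rfl

theorem M_inr_inr (i : Fin 4) (j : Fin 5) : M (.inr i) (.inr j) = B₂ i.succ j := rfl

/-- A nonzero integral functional on the columns of `[I | M]` has weight at least `4`, and at
least `6` if it does not vanish on the connecting element of the 2-sum. -/
theorem weight_M (y : Fin 5 ⊕ Fin 4 → ℤ) (z : Fin 4 ⊕ Fin 5 → ℤ)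
    (hz : ∀ j, (z j : ℝ) = ∑ i, (y i : ℝ) * M i j) :
    (y ≠ 0 → 4 ≤ ∑ i, |y i| + ∑ j, |z j|) ∧
    (y (.inl 0) - y (.inl 1) + y (.inl 2) ≠ 0 → 6 ≤ ∑ i, |y i| + ∑ j, |z j|) := by
  simp only [Sum.forall, Fin.forall_fin_succ, IsEmpty.forall_iff, and_true,
    Fintype.sum_sum_type, Fin.sum_univ_five, Fin.sum_univ_four, M_inl_inl, M_inl_inr, M_inr_inl,
    M_inr_inr] at hz
  simp [B₁, B₂] at hz
  norm_cast at hz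
  obtain ⟨⟨l₀, l₁, l₂, l₃⟩, r₀, r₁, r₂, r₃, r₄⟩ := hz
  have hL := weight_left (y₀ := y (.inl 0)) (y₁ := y (.inl 1)) (y₂ := y (.inl 2))
    (y₃ := y (.inl 3)) (y₄ := y (.inl 4)) (z₁ := z (.inl 0)) (z₂ := z (.inl 1))
    (z₃ := z (.inl 2)) (z₄ := z (.inl 3)) rfl (by omega) (by omega) (by omega) (by omega)
  have hR := weight_right (c := y (.inl 0) - y (.inl 1) + y (.inl 2)) (u₀ := y (.inr 0))
    (u₁ := y (.inr 1)) (u₂ := y (.inr 2))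
    (u₃ := y (.inr 3)) (w₀ := z (.inr 0)) (w₁ := z (.inr 1)) (w₂ := z (.inr 2))
    (w₃ := z (.inr 3)) (w₄ := z (.inr 4)) (by omega) (by omega) (by omega) (by omega) (by omega)
  have hy : y ≠ 0 → ¬ ((y (.inl 0) = 0 ∧ y (.inl 1) = 0 ∧ y (.inl 2) = 0 ∧ y (.inl 3) = 0 ∧
      y (.inl 4) = 0) ∧ y (.inr 0) = 0 ∧ y (.inr 1) = 0 ∧ y (.inr 2) = 0 ∧ y (.inr 3) = 0) := by
    rintro hne ⟨⟨a₀, a₁, a₂, a₃, a₄⟩, b₀, b₁, b₂, b₃⟩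
    refine hne (funext ?_)
    rintro (i | i) <;> fin_cases i <;> assumption
  have hsum : ∑ i, |y i| + ∑ j, |z j| =
      (|y (.inl 0)| + |y (.inl 1)| + |y (.inl 2)| + |y (.inl 3)| + |y (.inl 4)| +
        (|z (.inl 0)| + |z (.inl 1)| + |z (.inl 2)| + |z (.inl 3)|)) +
      (|y (.inr 0)| + |y (.inr 1)| + |y (.inr 2)| + |y (.inr 3)| +
        (|z (.inr 0)| + |z (.inr 1)| + |z (.inr 2)| + |z (.inr 3)| + |z (.inr 4)|)) := by
    simp [Fin.sum_univ_succ]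
    ring
  rw [hsum]
  generalize y (.inl 0) - y (.inl 1) + y (.inl 2) = c at *
  have hc : c ≠ 0 → 1 ≤ |c| := fun h => Int.one_le_abs h
  have h₁ : 0 ≤ |y (.inl 0)| + |y (.inl 1)| + |y (.inl 2)| + |y (.inl 3)| + |y (.inl 4)| +
        (|z (.inl 0)| + |z (.inl 1)| + |z (.inl 2)| + |z (.inl 3)|) := by positivity
  have h₂ : 0 ≤ |y (.inr 0)| + |y (.inr 1)| + |y (.inr 2)| + |y (.inr 3)| +
        (|z (.inr 0)| + |z (.inr 1)| + |z (.inr 2)| + |z (.inr 3)| + |z (.inr 4)|) := by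
    positivity
  generalize |y (.inl 0)| + |y (.inl 1)| + |y (.inl 2)| + |y (.inl 3)| + |y (.inl 4)| +
        (|z (.inl 0)| + |z (.inl 1)| + |z (.inl 2)| + |z (.inl 3)|) = S at *
  generalize |y (.inr 0)| + |y (.inr 1)| + |y (.inr 2)| + |y (.inr 3)| +
        (|z (.inr 0)| + |z (.inr 1)| + |z (.inr 2)| + |z (.inr 3)| + |z (.inr 4)|) = T at *
  generalize |c| = C at *
  -- If `c = 0`, a nonzero `y` is nonzero on one side, which alone weighs 4. Otherwise each side
  -- weighs at least 3.
  by_cases h : c = 0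
  · subst h
    refine ⟨fun hne => ?_, fun h => (h rfl).elim⟩
    have := hy hne
    have h₃ := hL.2 rfl
    have h₄ := hR.2 rfl
    clear hy hL hR
    by_contra hlt
    exact this ⟨h₃.resolve_left (by omega), h₄.resolve_left (by omega)⟩
  · have := hc h
    omega

/-- A matrix with a submatrix `M` that is zero in the rows outside `M` is not binet. -/
theorem not_isBinet_of_M {m n : Type} [Fintype m] [DecidableEq m] {N : Matrix m n ℝ}
    (f : Fin 5 ⊕ Fin 4 → m) (g : Fin 4 ⊕ Fin 5 → n) (hf : f.Injective)
    (hN : ∀ i j, N (f i) (g j) = M i j) (hN₀ : ∀ i ∉ Set.range f, ∀ j, N i (g j) = 0) :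
    ¬ IsBinet N := by
  rintro ⟨V, _, _, G, Rinv, h₁, h₂, h₃⟩
  have hRN : G.basicPart * N = G.nonbasicPart := by
    rw [h₃, ← Matrix.mul_assoc, h₁, Matrix.one_mul]
  set y : V → Fin 5 ⊕ Fin 4 → ℤ := fun v i => (G.edge (.inl (f i))).entry v
  set z : V → Fin 4 ⊕ Fin 5 → ℤ := fun v j => (G.edge (.inr (g j))).entry v
  have hyR (v i) : (y v i : ℝ) = G.basicPart v (f i) := rfl
  have hzy (v : V) (j) : (z v j : ℝ) = ∑ i, (y v i : ℝ) * M i j := by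
    have h : (z v j : ℝ) = ∑ k, G.basicPart v k * N k (g j) := by
      rw [← Matrix.mul_apply, hRN]; rfl
    rw [h]
    symm
    simp only [hyR, ← hN]
    -- Basic edges outside the range of `f` drop out, because `N` vanishes there in the columns of
    -- `M`.
    refine Finset.sum_of_injOn f hf.injOn (by simp) (fun k _ hk => ?_) (fun i _ => rfl)
    rw [hN₀ k (by simpa using hk), mul_zero]
  -- at least nine nodes carry a nonzero functional
  have hinj (x : Fin 5 ⊕ Fin 4 → ℝ) (hx : ∀ v, y v ≠ 0 → ∑ i, (y v i : ℝ) * x i = 0) : x = 0 := by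
    have hall (v : V) : ∑ i, G.basicPart v (f i) * x i = 0 := by
      by_cases h : y v = 0
      · refine Finset.sum_eq_zero fun i _ => ?_
        rw [← hyR, h]; simp
      · exact hx v h
    funext i
    calc x i = ∑ k, (1 : Matrix m m ℝ) (f i) (f k) * x k := by
          simp [Matrix.one_apply, hf.eq_iff]
      _ = ∑ k, ∑ v, Rinv (f i) v * (G.basicPart v (f k) * x k) := by
          refine Finset.sum_congr rfl fun k _ => ?_
          rw [← h₂, Matrix.mul_apply, Finset.sum_mul]
          simp only [mul_assoc]
      _ = 0 := by
          rw [Finset.sum_comm]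
          refine Finset.sum_eq_zero fun v _ => ?_
          rw [← Finset.mul_sum, hall, mul_zero]
  have hcard : 9 ≤ (Finset.univ.filter fun v => y v ≠ 0).card := by
    let φ : (Fin 5 ⊕ Fin 4 → ℝ) →ₗ[ℝ] ({v // y v ≠ 0} → ℝ) :=
      Matrix.mulVecLin (Matrix.of fun v i => (y v i : ℝ))
    have hφ : Function.Injective φ := by
      rw [← LinearMap.ker_eq_bot, LinearMap.ker_eq_bot']
      intro x hx
      refine hinj x fun v hv => ?_
      simpa [φ, Matrix.mulVec, dotProduct] using congrFun hx ⟨v, hv⟩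
    have := LinearMap.finrank_le_finrank_of_injective hφ
    simpa [Fintype.card_subtype] using this
  obtain ⟨v₀, hv₀⟩ : ∃ v, y v (.inl 0) - y v (.inl 1) + y v (.inl 2) ≠ 0 := by
    by_contra! h
    -- This vector is the first column of `B₁` extended by zero, that is, the connecting element; it
    -- is nonzero, so some node functional detects it.
    have := hinj (Sum.elim ![1, -1, 1, 0, 0] 0) fun v _ => by
      have := h v
      simp [Fin.sum_univ_succ]
      exact_mod_cast (by omega : y v (.inl 0) + (-y v (.inl 1) + y v (.inl 2)) = 0)
    simpa using congrFun this (.inl 0)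
  -- Here 38 = 9 · 4 + 2, the extra 2 coming from `v₀`.
  have hlower : 38 ≤ ∑ v, (∑ i, |y v i| + ∑ j, |z v j|) := by
    have hv (v : V) : ((if y v ≠ 0 then 4 else 0) + if v = v₀ then 2 else 0) ≤
        ∑ i, |y v i| + ∑ j, |z v j| := by
      obtain ⟨w₁, w₂⟩ := weight_M (y v) (z v) (hzy v)
      by_cases hvv : v = v₀
      · subst hvv
        have := w₂ hv₀
        split_ifs <;> omega
      · by_cases h : y v = 0
        · simp only [h, hvv, ne_eq, not_true_eq_false, if_false]; positivity
        · simpa [h, hvv] using w₁ h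
    refine le_trans ?_ (Finset.sum_le_sum fun v _ => hv v)
    rw [Finset.sum_add_distrib, ← Finset.sum_filter]
    simp only [Finset.sum_const, Finset.sum_ite_eq', Finset.mem_univ, if_true]
    simp only [nsmul_eq_mul]
    omega
  have hupper : ∑ v, (∑ i, |y v i| + ∑ j, |z v j|) ≤ 36 := by
    rw [Finset.sum_add_distrib, Finset.sum_comm, Finset.sum_comm (f := fun v j => |z v j|)]
    refine (add_le_add
      (Finset.sum_le_sum fun i _ => BidirectedEdge.sum_abs_entry_le_two (G.edge (.inl (f i))))
      (Finset.sum_le_sum fun j _ =>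
        BidirectedEdge.sum_abs_entry_le_two (G.edge (.inr (g j))))).trans ?_
    simp
  omega

theorem not_isBinet_M : ¬ IsBinet M :=
  not_isBinet_of_M id id Function.injective_id (fun _ _ => rfl) (by simp)

/-! ### Total unimodularity of `B₁` and `B₂` by evaluating minors -/

/-- Sorting the chosen rows and columns of a minor changes its determinant only by a sign, so
increasing selections suffice for the finite check. -/
theorem exists_strictMono_comp_perm {k : ℕ} {α : Type*} [LinearOrder α] {f : Fin k → α}
    (hf : f.Injective) : ∃ (g : Fin k → α) (σ : Equiv.Perm (Fin k)), StrictMono g ∧ f = g ∘ σ :=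
  ⟨f ∘ Tuple.sort f, (Tuple.sort f)⁻¹,
    (Tuple.monotone_sort f).strictMono_of_injective (hf.comp (Equiv.injective _)),
    funext fun i => by simp⟩

/-- The determinant by Laplace expansion, in a form that evaluates well. -/
def laplaceDet : (k : ℕ) → (Fin k → Fin k → ℤ) → ℤ
  | 0, _ => 1
  | k + 1, A => ∑ j : Fin (k + 1), if A 0 j = 0 then 0 else
      (-1) ^ (j : ℕ) * A 0 j * laplaceDet k fun i l => A i.succ (j.succAbove l)

theorem det_eq_laplaceDet {k : ℕ} (A : Matrix (Fin k) (Fin k) ℤ) : A.det = laplaceDet k A := by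
  induction k with
  | zero => simp [laplaceDet]
  | succ k ih =>
    rw [Matrix.det_succ_row_zero]
    change _ = ∑ j : Fin (k + 1), if A 0 j = 0 then 0 else
      (-1) ^ (j : ℕ) * A 0 j * laplaceDet k fun i l => A i.succ (j.succAbove l)
    refine Finset.sum_congr rfl fun j _ => ?_
    split_ifs with h
    · simp [h]
    · rw [ih]; rfl

/-- Total unimodularity only has to be checked on minors of increasing rows and columns. -/
theorem isTotallyUnimodular_of_laplaceDet {p q : ℕ} (A : Matrix (Fin p) (Fin q) ℤ)
    (hA : ∀ k : Fin (p + 1), ∀ f : Fin k → Fin p, (∀ i j, i < j → f i < f j) →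
      ∀ g : Fin k → Fin q, (∀ i j, i < j → g i < g j) →
      laplaceDet k (fun i j => A (f i) (g j)) ∈ ({0, 1, -1} : Finset ℤ)) :
    (A.map (Int.cast : ℤ → ℝ)).IsTotallyUnimodular := by
  intro k f g hf hg
  obtain ⟨f, σ, hf', rfl⟩ := exists_strictMono_comp_perm hf
  obtain ⟨g, τ, hg', rfl⟩ := exists_strictMono_comp_perm hg
  have hk : k ≤ p := by simpa using Fintype.card_le_of_injective f hf'.injective
  have hdet : ((A.map (Int.cast : ℤ → ℝ)).submatrix (f ∘ σ) (g ∘ τ)).det =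
      ((Equiv.Perm.sign σ * (Equiv.Perm.sign τ * (A.submatrix f g).det) : ℤ) : ℝ) := by
    have h : ((A.submatrix f g).submatrix σ τ).det =
        Equiv.Perm.sign σ * (Equiv.Perm.sign τ * (A.submatrix f g).det) := by
      have h₁ := Matrix.det_permute σ ((A.submatrix f g).submatrix id τ)
      have h₂ := Matrix.det_permute' τ (A.submatrix f g)
      simp only [Int.cast_id] at h₁ h₂
      rw [← h₂, ← h₁]
      rfl
    rw [← h, Int.cast_det]
    rfl
  have h : (A.submatrix f g).det ∈ ({0, 1, -1} : Finset ℤ) := by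
    rw [det_eq_laplaceDet]
    exact hA ⟨k, Nat.lt_succ_of_le hk⟩ f (fun _ _ h => hf' h) g fun _ _ h => hg' h
  have h' : (Equiv.Perm.sign σ * (Equiv.Perm.sign τ * (A.submatrix f g).det) : ℤ) = 0 ∨
      (Equiv.Perm.sign σ * (Equiv.Perm.sign τ * (A.submatrix f g).det) : ℤ) = 1 ∨
      (Equiv.Perm.sign σ * (Equiv.Perm.sign τ * (A.submatrix f g).det) : ℤ) = -1 := by
    simp only [Finset.mem_insert, Finset.mem_singleton] at h
    rcases Int.units_eq_one_or (Equiv.Perm.sign σ) with hs | hs <;>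
      rcases Int.units_eq_one_or (Equiv.Perm.sign τ) with ht | ht <;>
      rcases h with h | h | h <;> rw [hs, ht, h] <;> simp
  rw [hdet]
  rcases h' with h' | h' | h' <;> rw [h']
  exacts [⟨0, by simp⟩, ⟨1, by simp⟩, ⟨-1, by simp⟩]

def B₁Int : Matrix (Fin 5) (Fin 5) ℤ :=
  !![ 1,  0,  0,  1, -1;
     -1,  1,  0,  0,  1;
      1, -1,  1,  0,  0;
      0,  1, -1,  1,  0;
      0,  0,  1, -1,  1]

def B₂Int : Matrix (Fin 5) (Fin 5) ℤ :=
  !![1, 1, 1, 1, 1;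
     1, 1, 1, 0, 0;
     1, 0, 1, 1, 0;
     1, 0, 0, 1, 1;
     1, 1, 0, 0, 1]

theorem B₁_eq : B₁ = B₁Int.map (Int.cast : ℤ → ℝ) := by
  ext i j; fin_cases i <;> fin_cases j <;> simp [B₁, B₁Int]

theorem B₂_eq : B₂ = B₂Int.map (Int.cast : ℤ → ℝ) := by
  ext i j; fin_cases i <;> fin_cases j <;> simp [B₂, B₂Int]

theorem isTotallyUnimodular_B₁ : B₁.IsTotallyUnimodular := by
  rw [B₁_eq]
  exact isTotallyUnimodular_of_laplaceDet _ (by decide +kernel)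

theorem isTotallyUnimodular_B₂ : B₂.IsTotallyUnimodular := by
  rw [B₂_eq]
  exact isTotallyUnimodular_of_laplaceDet _ (by decide +kernel)

/-! ### Binet representations of `B₁` and `B₂` -/

variable {V m m' n n' : Type}

/-- A binet representation given by integral matrices, with the inverse of the basis doubled. -/
theorem isBinet_of_int {k : ℕ} {l : Type} (G : BidirectedGraph (Fin k) (Fin k ⊕ l))
    (B : Matrix (Fin k) l ℤ) (R T : Matrix (Fin k) (Fin k) ℤ)
    (hR : ∀ v i, (G.edge (.inl i)).entry v = R v i) (hRT : R * T = 2)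
    (hRB : ∀ v j, (G.edge (.inr j)).entry v = (R * B) v j) :
    IsBinet (B.map (Int.cast : ℤ → ℝ)) := by
  have hbasic : G.basicPart = R.map (Int.castRingHom ℝ) := by
    ext v i
    simp [BidirectedGraph.basicPart, BidirectedGraph.incidence, hR]
  have hnonbasic : G.nonbasicPart = G.basicPart * B.map (Int.castRingHom ℝ) := by
    rw [hbasic, ← Matrix.map_mul]
    ext v j
    simp [BidirectedGraph.nonbasicPart, BidirectedGraph.incidence, hRB]
  have h₁ : G.basicPart * ((2⁻¹ : ℝ) • T.map (Int.castRingHom ℝ)) = 1 := by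
    rw [Matrix.mul_smul, hbasic, ← Matrix.map_mul, hRT]
    ext i j
    by_cases h : i = j <;> simp [h, Matrix.one_apply, Matrix.ofNat_apply]
  have h₂ := mul_eq_one_comm.mp h₁
  refine ⟨Fin k, inferInstance, inferInstance, G, _, h₁, h₂, ?_⟩
  rw [hnonbasic, ← Matrix.mul_assoc, h₂, Matrix.one_mul]
  rfl

/-- The edges are the ten links of the complete graph on five nodes, all negative. The basis
contains the triangle 0, 1, 3, an odd cycle of negative links, so `R⁻¹` is only half-integral and
its double is given. -/
theorem isBinet_B₁ : IsBinet B₁ := by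
  rw [B₁_eq]
  refine isBinet_of_int (k := 5)
    ⟨Sum.elim ![.link 0 1 (by decide) 1 1, .link 0 2 (by decide) 1 1, .link 1 3 (by decide) (-1) (-1),
        .link 0 3 (by decide) (-1) (-1), .link 1 4 (by decide) 1 1]
      ![.link 2 3 (by decide) (-1) (-1), .link 1 2 (by decide) 1 1, .link 0 4 (by decide) 1 1,
        .link 3 4 (by decide) (-1) (-1), .link 2 4 (by decide) 1 1]⟩ _
    !![1, 1, 0, -1, 0; 1, 0, -1, 0, 1; 0, 1, 0, 0, 0; 0, 0, -1, -1, 0; 0, 0, 0, 0, 1]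
    !![1, 1, -1, -1, -1; 0, 0, 2, 0, 0; 1, -1, -1, -1, 1; -1, 1, 1, -1, -1; 0, 0, 0, 0, 2]
    (fun v i => ?_) (by decide +kernel) fun v i => ?_ <;> fin_cases v <;> fin_cases i <;> rfl

/-- The same graph with another basis, whose cycle is the triangle 0, 2, 4. -/
theorem isBinet_B₂ : IsBinet B₂ := by
  rw [B₂_eq]
  refine isBinet_of_int (k := 5)
    ⟨Sum.elim ![.link 0 1 (by decide) 1 1, .link 0 2 (by decide) (-1) (-1),
        .link 1 3 (by decide) (-1) (-1), .link 0 4 (by decide) (-1) (-1), .link 2 4 (by decide) 1 1]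
      ![.link 0 3 (by decide) (-1) (-1), .link 1 4 (by decide) 1 1, .link 2 3 (by decide) (-1) (-1),
        .link 3 4 (by decide) (-1) (-1), .link 1 2 (by decide) 1 1]⟩ _
    !![1, -1, 0, -1, 0; 1, 0, -1, 0, 0; 0, -1, 0, 0, 1; 0, 0, -1, 0, 0; 0, 0, 0, -1, 1]
    !![0, 2, 0, -2, 0; -1, 1, -1, -1, 1; 0, 0, 0, -2, 0; -1, 1, 1, -1, -1; -1, 1, 1, -1, 1]
    (fun v i => ?_) (by decide +kernel) fun v i => ?_ <;> fin_cases v <;> fin_cases i <;> rfl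

theorem isTUBinet_B₁ : IsTUBinet B₁ := ⟨isTotallyUnimodular_B₁, isBinet_B₁⟩

theorem isTUBinet_B₂ : IsTUBinet B₂ := ⟨isTotallyUnimodular_B₂, isBinet_B₂⟩

/-! ### Parallel, unit and series extensions of binet matrices -/

section Closure

variable [Fintype m] [DecidableEq m] [Fintype m'] [DecidableEq m'] {B : Matrix m n ℝ}

/-- Columns of `[I | B]` may be chosen freely, by taking parallel edges. -/
theorem IsBinet.submatrix_cols (hB : IsBinet B) (g : n' → m ⊕ n) :
    IsBinet ((Matrix.fromCols 1 B).submatrix id g) := by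
  obtain ⟨V, _, _, G, Rinv, h₁, h₂, rfl⟩ := hB
  refine ⟨V, inferInstance, inferInstance,
    ⟨Sum.elim (fun i => G.edge (.inl i)) fun j => G.edge (g j)⟩, Rinv, h₁, h₂, ?_⟩
  ext i j
  rcases hj : g j with k | k
  · simp only [Matrix.submatrix_apply, id, hj, Matrix.fromCols_apply_inl]
    rw [← h₂, Matrix.mul_apply, Matrix.mul_apply]
    simp [BidirectedGraph.basicPart, BidirectedGraph.nonbasicPart, BidirectedGraph.incidence, hj]
  · simp only [Matrix.submatrix_apply, id, hj, Matrix.fromCols_apply_inr, Matrix.mul_apply]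
    simp [BidirectedGraph.nonbasicPart, BidirectedGraph.incidence, hj]

theorem IsTUBinet.submatrix_cols (hB : IsTUBinet B) (g : n' → m ⊕ n) :
    IsTUBinet ((Matrix.fromCols 1 B).submatrix id g) :=
  ⟨hB.1.one_fromCols.submatrix _ _, hB.2.submatrix_cols g⟩

theorem IsBinet.submatrix_rows (hB : IsBinet B) (e : m' ≃ m) : IsBinet (B.submatrix e id) := by
  obtain ⟨V, _, _, G, Rinv, h₁, h₂, rfl⟩ := hB
  let G' : BidirectedGraph V (m' ⊕ n) := ⟨fun x => G.edge (x.map e id)⟩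
  have hG : G'.basicPart = G.basicPart.submatrix id e := rfl
  refine ⟨V, inferInstance, inferInstance, G', Rinv.submatrix e id, ?_, ?_, rfl⟩
  · rw [hG, Matrix.submatrix_mul_equiv, h₁]; rfl
  · rw [hG, ← Matrix.submatrix_mul _ _ _ _ _ Function.bijective_id, h₂]
    simp

theorem IsTUBinet.submatrix_rows (hB : IsTUBinet B) (e : m' ≃ m) :
    IsTUBinet (B.submatrix e id) :=
  ⟨hB.1.submatrix _ _, hB.2.submatrix_rows e⟩

end Closure

namespace BidirectedEdge

variable {W : Type} [DecidableEq V] [DecidableEq W]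

def map (f : V ↪ W) : BidirectedEdge V → BidirectedEdge W
  | link u v huv s t => link (f u) (f v) (f.injective.ne huv) s t
  | loop v s t => loop (f v) s t
  | halfEdge v s => halfEdge (f v) s
  | loose => loose

theorem entry_map_inl (e : BidirectedEdge V) (v : V) :
    (e.map (Function.Embedding.inl : V ↪ V ⊕ W)).entry (.inl v) = e.entry v := by
  cases e <;> simp [map, entry]

theorem entry_map_inr (e : BidirectedEdge V) (w : W) :
    (e.map (Function.Embedding.inl : V ↪ V ⊕ W)).entry (.inr w) = 0 := by
  cases e <;> simp [map, entry]

/-- Subdividing the edge `e` by a new node: `e` is the difference of two edges `e₂`, `e₁` that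
share the new node. -/
theorem exists_subdivision (e : BidirectedEdge V) : ∃ e₁ e₂ : BidirectedEdge (V ⊕ Fin 1),
    (∀ w, e₁.entry (.inr w) = 1) ∧ (∀ w, e₂.entry (.inr w) = 1) ∧
    ∀ v, e₂.entry (.inl v) = e.entry v + e₁.entry (.inl v) := by
  cases e with
  | link u v huv s t =>
    -- Both edges carry `+1` at the new node, so the end at `v` must be negated on `e₁` for `e₂ -
    -- e₁` to restore `e`.
    refine ⟨.link (.inl v) (.inr 0) (by simp) (-t) 1, .link (.inl u) (.inr 0) (by simp) s 1,
      fun w => ?_, fun w => ?_, fun x => ?_⟩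
    · simp [entry, Subsingleton.elim w 0]
    · simp [entry, Subsingleton.elim w 0]
    · by_cases hu : x = u
      · subst hu; simp [entry, huv]
      · by_cases hv : x = v <;> simp [entry, hu, hv]
        subst hv; simp [hu]
  | loop v s t =>
    refine ⟨.link (.inl v) (.inr 0) (by simp) (-t) 1, .link (.inl v) (.inr 0) (by simp) s 1,
      fun w => ?_, fun w => ?_, fun x => ?_⟩
    · simp [entry, Subsingleton.elim w 0]
    · simp [entry, Subsingleton.elim w 0]
    · by_cases hv : x = v <;> simp [entry, hv]
  | halfEdge v s =>
    refine ⟨.halfEdge (.inr 0) 1, .link (.inl v) (.inr 0) (by simp) s 1,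
      fun w => ?_, fun w => ?_, fun x => ?_⟩
    · simp [entry, Subsingleton.elim w 0]
    · simp [entry, Subsingleton.elim w 0]
    · by_cases hv : x = v <;> simp [entry, hv]
  | loose =>
    refine ⟨.halfEdge (.inr 0) 1, .halfEdge (.inr 0) 1, fun w => ?_, fun w => ?_, fun x => ?_⟩
    · simp [entry, Subsingleton.elim w 0]
    · simp [entry, Subsingleton.elim w 0]
    · simp [entry]

end BidirectedEdge

section Closure

variable [Fintype m] [DecidableEq m] [DecidableEq n] {B : Matrix m n ℝ}

/-- A unit row may be added, by subdividing the edge of its column. -/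
theorem IsBinet.fromRows_single (hB : IsBinet B) (j : n) :
    IsBinet (Matrix.fromRows B (Matrix.replicateRow (Fin 1) (Pi.single j 1))) := by
  obtain ⟨V, _, _, G, Rinv, h₁, h₂, h₃⟩ := hB
  obtain ⟨e₁, e₂, he₁, he₂, he⟩ := (G.edge (.inr j)).exists_subdivision
  let G' : BidirectedGraph (V ⊕ Fin 1) ((m ⊕ Fin 1) ⊕ n) :=
    ⟨Sum.elim (Sum.elim (fun i => (G.edge (.inl i)).map .inl) fun _ => e₁)
      fun k => if k = j then e₂ else (G.edge (.inr k)).map .inl⟩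
  let r : Matrix V (Fin 1) ℝ := Matrix.of fun v _ => (e₁.entry (.inl v) : ℝ)
  have hbasic : G'.basicPart = Matrix.fromBlocks G.basicPart r 0 1 := by
    ext (v | v) (i | i) <;>
      simp [BidirectedGraph.basicPart, BidirectedGraph.incidence, G', r, he₁,
        BidirectedEdge.entry_map_inl, BidirectedEdge.entry_map_inr,
        Matrix.one_apply, eq_iff_true_of_subsingleton]
  have hRB : G.basicPart * B = G.nonbasicPart := by
    rw [h₃, ← Matrix.mul_assoc, h₁, Matrix.one_mul]
  have hnonbasic : G'.basicPart *
      Matrix.fromRows B (Matrix.replicateRow (Fin 1) (Pi.single j 1)) = G'.nonbasicPart := by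
    rw [hbasic, Matrix.fromBlocks_mul_fromRows, hRB]
    ext (v | v) k <;> by_cases hk : k = j <;>
      simp [BidirectedGraph.nonbasicPart, BidirectedGraph.incidence, G', r, he₂, he, hk,
        BidirectedEdge.entry_map_inl, BidirectedEdge.entry_map_inr, Matrix.mul_apply]
  have h₁' : G'.basicPart * Matrix.fromBlocks Rinv (-(Rinv * r)) 0 (1 : Matrix (Fin 1) (Fin 1) ℝ) = 1 := by
    rw [hbasic, Matrix.fromBlocks_multiply]
    simp [← Matrix.mul_assoc, h₁]
  have h₂' : Matrix.fromBlocks Rinv (-(Rinv * r)) 0 (1 : Matrix (Fin 1) (Fin 1) ℝ) * G'.basicPart = 1 := by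
    rw [hbasic, Matrix.fromBlocks_multiply]
    simp [h₂]
  -- The new basic edge `e₁` makes the basis block triangular, and replacing edge `j` by `e₂` adds
  -- `e₁` to its column, which is the effect of the unit row.
  refine ⟨V ⊕ Fin 1, inferInstance, inferInstance, G', _, h₁', h₂', ?_⟩
  rw [← hnonbasic, ← Matrix.mul_assoc, h₂', Matrix.one_mul]

theorem IsTUBinet.fromRows_single (hB : IsTUBinet B) (j : n) :
    IsTUBinet (Matrix.fromRows B (Matrix.replicateRow (Fin 1) (Pi.single j 1))) :=
  ⟨hB.1.fromRows_unitlike fun _ _ => ⟨j, 1, funext fun k => by simp⟩, hB.2.fromRows_single j⟩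

end Closure

/-! ### The three counterexamples -/

theorem exists_twoSum_not_isBinet :
    ∃ (p q r s : ℕ) (A : Matrix (Fin p) (Fin q) ℝ) (a : Fin p → ℝ) (b : Fin s → ℝ)
      (B : Matrix (Fin r) (Fin s) ℝ),
      IsTUBinet (twoSumLeft A a) ∧ IsTUBinet (twoSumRight b B) ∧ ¬ IsBinet (twoSum A a b B) := by
  refine ⟨5, 4, 4, 5, B₁.submatrix id Fin.succ, fun i => B₁ i 0, B₂ 0, B₂.submatrix Fin.succ id,
    ?_, ?_, not_isBinet_M⟩
  · convert isTUBinet_B₁.submatrix_cols (Sum.elim (fun j : Fin 4 => .inr j.succ)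
      fun _ : Fin 1 => .inr 0) using 1
    ext i (j | j) <;> rfl
  · convert isTUBinet_B₂.submatrix_rows
      (Equiv.ofBijective (Sum.elim (fun _ : Fin 1 => 0) Fin.succ) (by decide)) using 1
    ext (i | i) j <;> rfl

/-- The vectors `c` and `d` are unit vectors at the added column and row, so `dc` has a single
nonzero entry, in their common corner. The added row is thus zero on the columns of `M`. The terms
are `B₁` with repeated copies of its first column, one of them subdivided, and `B₂` with a unit
column subdivided. -/
theorem exists_threeSum_not_isBinet :
    ∃ (p q r s : ℕ) (A : Matrix (Fin p) (Fin q) ℝ) (a : Fin p → ℝ) (c : Fin q → ℝ)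
      (b : Fin s → ℝ) (d : Fin r → ℝ) (B : Matrix (Fin r) (Fin s) ℝ),
      IsTUBinet (threeSumLeft A a c) ∧ IsTUBinet (threeSumRight b d B) ∧
      ¬ IsBinet (threeSum A a c b d B) := by
  refine ⟨5, 5, 5, 5, B₁.submatrix id ![1, 2, 3, 4, 0], fun i => B₁ i 0, ![0, 0, 0, 0, 1], B₂ 0,
    ![0, 0, 0, 0, 1], Matrix.of ![B₂ 1, B₂ 2, B₂ 3, B₂ 4, 0], ?_, ?_, ?_⟩
  · convert ((isTUBinet_B₁.submatrix_cols
      (.inr ∘ ![1, 2, 3, 4, 0, 0] : Fin 6 → Fin 5 ⊕ Fin 5)).fromRows_single 4).submatrix_cols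
      (.inr ∘ Sum.elim ![0, 1, 2, 3, 4] ![5, 4] : Fin 5 ⊕ Fin 2 → (Fin 5 ⊕ Fin 1) ⊕ Fin 6) using 1
    ext (i | i) (j | j) <;> fin_cases i <;> fin_cases j <;> rfl
  · convert ((isTUBinet_B₂.submatrix_cols
      (Sum.elim (fun _ : Fin 1 => .inl 0) .inr)).fromRows_single (.inl 0)).submatrix_cols
      (Sum.elim ![.inr (.inl 0), .inl (.inr 0)] fun j : Fin 5 => .inr (.inr j)) |>.submatrix_rows
      (Equiv.ofBijective
        (Sum.elim (fun _ : Fin 1 => .inl 0) ![.inl 1, .inl 2, .inl 3, .inl 4, .inr 0])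
        (by decide)) using 1
    ext (i | i) (j | j)
    · fin_cases i; fin_cases j <;> rfl
    · rfl
    · fin_cases i <;> fin_cases j <;> rfl
    · fin_cases i <;> rfl
  · refine not_isBinet_of_M (Sum.map id Fin.castSucc) (Sum.map Fin.castSucc id)
      (Sum.map_injective.mpr ⟨Function.injective_id, Fin.castSucc_injective _⟩) ?_ ?_
    · rintro (i | i) (j | j)
      · fin_cases j <;> rfl
      · rfl
      · have hd : (![0, 0, 0, 0, 1] : Fin 5 → ℝ) i.castSucc = 0 := by fin_cases i <;> rfl
        exact mul_eq_zero_of_left hd _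
      · fin_cases i <;> rfl
    · rintro (i | i) hi
      · exact absurd ⟨.inl i, rfl⟩ hi
      · induction i using Fin.lastCases with
        | last =>
          rintro (j | j)
          · have hc : (![0, 0, 0, 0, 1] : Fin 5 → ℝ) j.castSucc = 0 := by fin_cases j <;> rfl
            exact mul_eq_zero_of_right _ hc
          · rfl
        | cast i => exact absurd ⟨.inr i, rfl⟩ hi

/-- The criterion for a block of an alternative 3-sum when its distinguished `2 × 2` submatrix is
`[1 1; 0 1]`. -/
theorem isAltThreeSumBlock_of_submatrix {q r : ℕ} {b c : Fin q → ℝ} {a d : Fin r → ℝ}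
    {D : Matrix (Fin r) (Fin q) ℝ} {i : Fin 2 → Fin r} {j : Fin 2 → Fin q}
    (hi : D.submatrix i id = Matrix.of ![b, c])
    (hj : D.submatrix id j = (Matrix.of ![a, d]).transpose)
    (hij : D.submatrix i j = (!![1, 1; 0, 1] : Matrix (Fin 2) (Fin 2) ℝ))
    (hD : D = (Matrix.of ![a, d]).transpose *
      (!![1, -1; 0, 1] : Matrix (Fin 2) (Fin 2) ℝ) * Matrix.of ![b, c]) :
    IsAltThreeSumBlock b c a d D := by
  have hinv : (!![1, 1; 0, 1] : Matrix (Fin 2) (Fin 2) ℝ)⁻¹ = !![1, -1; 0, 1] := by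
    refine Matrix.inv_eq_right_inv ?_
    ext i j; fin_cases i <;> fin_cases j <;> simp [Matrix.mul_apply]
  have hdet : (!![1, 1; 0, 1] : Matrix (Fin 2) (Fin 2) ℝ).det = 1 := by simp
  refine ⟨i, j, hi, hj, by simp [hij, hdet], by rw [hij, hinv]; exact hD, le_antisymm ?_ ?_⟩
  · rw [hD, Matrix.mul_assoc]
    exact (Matrix.rank_mul_le_left _ _).trans (Matrix.rank_le_width _)
  · have h := Matrix.rank_submatrix_le D i j
    rwa [hij, Matrix.rank_of_isUnit _ ((Matrix.isUnit_iff_isUnit_det _).mpr (by simp [hdet])),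
      Fintype.card_fin] at h

/-- The roles are exchanged: `B₂` supplies the first term and `B₁` the second, so that the rank-one
block of `M` lands in `D`. One additional row and column, meeting in an entry 1, raise the rank of
`D` to two; that row is zero on the columns of `M`. -/
theorem exists_altThreeSum_not_isBinet :
    ∃ (p q r s : ℕ) (A : Matrix (Fin p) (Fin q) ℝ) (b c : Fin q → ℝ) (a d : Fin r → ℝ)
      (B : Matrix (Fin r) (Fin s) ℝ) (D : Matrix (Fin r) (Fin q) ℝ),
      IsTUBinet (altThreeSumLeft A b c) ∧ IsTUBinet (altThreeSumRight a d B) ∧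
      IsAltThreeSumBlock b c a d D ∧ ¬ IsBinet (altThreeSum A D B) := by
  refine ⟨4, 6, 6, 4,
    Matrix.of fun i => ![B₂ i.succ 0, B₂ i.succ 1, B₂ i.succ 2, B₂ i.succ 3, B₂ i.succ 4, 0],
    ![1, 1, 1, 1, 1, 1], ![0, 0, 0, 0, 0, 1], ![1, -1, 1, 0, 0, 0], ![1, -1, 1, 0, 0, 1],
    (Matrix.of ![B₁ 0, B₁ 1, B₁ 2, B₁ 3, B₁ 4, 0]).submatrix id Fin.succ,
    !![1, 1, 1, 1, 1, 1; -1, -1, -1, -1, -1, -1; 1, 1, 1, 1, 1, 1; 0, 0, 0, 0, 0, 0;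
      0, 0, 0, 0, 0, 0; 0, 0, 0, 0, 0, 1], ?_, ?_, ?_, ?_⟩
  · convert ((isTUBinet_B₂.submatrix_cols
      (Sum.elim (fun _ : Fin 1 => .inl 0) .inr)).fromRows_single (.inl 0)).submatrix_cols
      (Sum.elim ![.inr (.inr 0), .inr (.inr 1), .inr (.inr 2), .inr (.inr 3), .inr (.inr 4),
        .inr (.inl 0)] fun _ : Fin 1 => .inr (.inl 0)) |>.submatrix_rows
      (Equiv.ofBijective
        (Sum.elim (fun i : Fin 4 => .inl i.succ) ![.inl 0, .inr 0]) (by decide)) using 1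
    ext (i | i) (j | j)
    · fin_cases j <;> rfl
    · rfl
    · fin_cases i <;> fin_cases j <;> rfl
    · fin_cases i <;> fin_cases j <;> rfl
  · convert (((isTUBinet_B₁.fromRows_single 0).submatrix_cols
      (.inr ∘ ![0, 0, 1, 2, 3, 4] : Fin 6 → (Fin 5 ⊕ Fin 1) ⊕ Fin 5)).fromRows_single
        1).submatrix_rows (Equiv.ofBijective
        (Sum.elim (fun _ : Fin 1 => .inl (.inr 0)) ![.inl (.inl 0), .inl (.inl 1), .inl (.inl 2),
          .inl (.inl 3), .inl (.inl 4), .inr 0]) (by decide)) |>.submatrix_cols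
        (.inr ∘ Sum.elim ![0, 1] ![2, 3, 4, 5] : Fin 2 ⊕ Fin 4 → (Fin 1 ⊕ Fin 6) ⊕ Fin 6) using 1
    ext (i | i) (j | j)
    · fin_cases i; fin_cases j <;> rfl
    · fin_cases i; fin_cases j <;> rfl
    · fin_cases i <;> fin_cases j <;> rfl
    · fin_cases i <;> fin_cases j <;> rfl
  -- Index 0 is a row and a column of the block inherited from `M`, index 5 the added row and
  -- column.
  · refine isAltThreeSumBlock_of_submatrix (i := ![0, 5]) (j := ![0, 5]) ?_ ?_ ?_ ?_
    · ext i j; fin_cases i <;> rfl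
    · ext i j; fin_cases i <;> fin_cases j <;> rfl
    · ext i j; fin_cases i <;> fin_cases j <;> rfl
    · ext i j
      rw [Matrix.mul_apply, Fin.sum_univ_two, Matrix.mul_apply, Matrix.mul_apply,
        Fin.sum_univ_two, Fin.sum_univ_two]
      fin_cases i <;> fin_cases j <;> norm_num
  -- The two summands of `M` appear in exchanged order, so the embeddings swap `inl` and `inr`.
  · refine not_isBinet_of_M (Sum.elim (fun i => .inr i.castSucc) .inl)
      (Sum.elim .inr fun j => .inl j.castSucc) (by decide) ?_ ?_
    · rintro (i | i) (j | j)
      · fin_cases i <;> rfl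
      · rw [M_inl_inr]
        fin_cases i <;> fin_cases j <;> simp [altThreeSum, B₁, B₂]
      · rfl
      · fin_cases j <;> rfl
    · rintro (i | i) hi
      · exact absurd ⟨.inr i, rfl⟩ hi
      · induction i using Fin.lastCases with
        | last =>
          rintro (j | j)
          · rfl
          · fin_cases j <;> rfl
        | cast i => exact absurd ⟨.inl i, rfl⟩ hi

end BinetSum

theorem mainTheorem3 :
    -- the two terms are totally unimodular binet matrices
    (BinetSum.IsTUBinet BinetSum.B₁ ∧ BinetSum.IsTUBinet BinetSum.B₂) ∧
    -- their 2-sum `M` has no representation of type I or type II, and is not binet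
    (¬ BinetSum.HasTypeIRepresentation BinetSum.M ∧
      ¬ BinetSum.HasTypeIIRepresentation BinetSum.M ∧
      ¬ BinetSum.IsBinet BinetSum.M) ∧
    -- totally unimodular binet matrices are not closed under 2-sums
    (∃ (p q r s : ℕ) (A : Matrix (Fin p) (Fin q) ℝ) (a : Fin p → ℝ) (b : Fin s → ℝ)
      (B : Matrix (Fin r) (Fin s) ℝ),
      BinetSum.IsTUBinet (BinetSum.twoSumLeft A a) ∧
      BinetSum.IsTUBinet (BinetSum.twoSumRight b B) ∧
      ¬ BinetSum.IsBinet (BinetSum.twoSum A a b B)) ∧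
    -- totally unimodular binet matrices are not closed under 3-sums, in the first form
    (∃ (p q r s : ℕ) (A : Matrix (Fin p) (Fin q) ℝ) (a : Fin p → ℝ) (c : Fin q → ℝ)
      (b : Fin s → ℝ) (d : Fin r → ℝ) (B : Matrix (Fin r) (Fin s) ℝ),
      BinetSum.IsTUBinet (BinetSum.threeSumLeft A a c) ∧
      BinetSum.IsTUBinet (BinetSum.threeSumRight b d B) ∧
      ¬ BinetSum.IsBinet (BinetSum.threeSum A a c b d B)) ∧
    -- nor in the alternative form
    (∃ (p q r s : ℕ) (A : Matrix (Fin p) (Fin q) ℝ) (b c : Fin q → ℝ) (a d : Fin r → ℝ)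
      (B : Matrix (Fin r) (Fin s) ℝ) (D : Matrix (Fin r) (Fin q) ℝ),
      BinetSum.IsTUBinet (BinetSum.altThreeSumLeft A b c) ∧
      BinetSum.IsTUBinet (BinetSum.altThreeSumRight a d B) ∧
      BinetSum.IsAltThreeSumBlock b c a d D ∧
      ¬ BinetSum.IsBinet (BinetSum.altThreeSum A D B)) := by
  exact ⟨⟨BinetSum.isTUBinet_B₁, BinetSum.isTUBinet_B₂⟩,
    ⟨fun ⟨V, hV, hV', G, hG, _⟩ => BinetSum.not_isBinet_M ⟨V, hV, hV', G, hG⟩,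
      fun ⟨V, hV, hV', G, hG, _⟩ => BinetSum.not_isBinet_M ⟨V, hV, hV', G, hG⟩,
      BinetSum.not_isBinet_M⟩,
    BinetSum.exists_twoSum_not_isBinet, BinetSum.exists_threeSum_not_isBinet,
    BinetSum.exists_altThreeSum_not_isBinet⟩
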